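/- Let $f_k:=\prod_{i\ge 1}(1-q^{ki})$ (a formal power series in $q$ with integer coefficients), let the integers $P^\ast(n)$, $n\ge 0$, be defined by \[ \sum_{n\ge 0}P^\ast(n)q^n=f_1^4f_5^4, \] and let $\lambda(q):=q f_1^4f_5^4$. Then for all integers $n\ge 0$, \[ P^\ast(8n+7)\equiv 0 \pmod{64},\qquad P^\ast(32n+31)\equiv 0 \pmod{256},\qquad P^\ast(64n+63)\equiv 0 \pmod{512}. \] Moreover, as formal power series in $q$, \begin{align*} \sum_{n\ge 0}P^\ast(8n+7)q^{n+1}&=-64\,\lambda(q^2),\\ \sum_{n\ge 0}P^\ast(32n+31)q^{n+1}&=256\,\lambda(q)+512\,\lambda(q^2),\\ \sum_{n\ge 0}P^\ast(64n+63)q^{n+1}&=-512\,\lambda(q)-2048\,\lambda(q^2). \end{align*} -/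

import Mathlib

namespace PStar

open PowerSeries
open scoped PowerSeries.WithPiTopology

/-- The `q`-Pochhammer symbol `(a; x)_∞ = ∏_{i ≥ 0} (1 - a x^i)` in the ring `ℤ⟦q⟧` of formal
power series, the infinite product being taken coefficientwise (`ℤ` is discrete). -/
noncomputable def qPochhammer (a x : ℤ⟦X⟧) : ℤ⟦X⟧ :=
  ∏' i : ℕ, (1 - a * x ^ i)

/-- `f_k = (q^k; q^k)_∞`, where `q = X` is the formal variable. -/
noncomputable def f (k : ℕ) : ℤ⟦X⟧ :=
  qPochhammer (X ^ k) (X ^ k)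

/-- For `k ≥ 1` the product that defines `f k` converges, so that its value is the true one. -/
theorem hasProd_f {k : ℕ} (hk : 0 < k) :
    HasProd (fun i : ℕ => (1 : ℤ⟦X⟧) - X ^ k * (X ^ k) ^ i) (f k) := by
  have h : Multipliable (fun i : ℕ => (1 : ℤ⟦X⟧) - X ^ k * (X ^ k) ^ i) := by
    simp_rw [sub_eq_add_neg]
    apply WithPiTopology.multipliable_one_add_of_tendsto_order_atTop_nhds_top
    refine ENat.tendsto_nhds_top_iff_natCast_lt.mpr
      (fun n => Filter.eventually_atTop.mpr ⟨n, fun m hm => ?_⟩)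
    rw [order_neg, ← pow_mul, ← pow_add, order_X_pow]
    norm_cast
    nlinarith
  exact h.hasProd

/-- `P*(n)`, the coefficient of `q^n` in `f_1^4 f_5^4`. -/
noncomputable def P (n : ℕ) : ℤ :=
  coeff n (f 1 ^ 4 * f 5 ^ 4)

/-- `λ(q) = q f_1^4 f_5^4`. -/
noncomputable def lam : ℤ⟦X⟧ :=
  X * f 1 ^ 4 * f 5 ^ 4

/-- `λ(q^2)`. -/
noncomputable def lamSq : ℤ⟦X⟧ :=
  expand 2 two_ne_zero lam

end PStar

namespace PStar

open PowerSeries Filter Topology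
open scoped PowerSeries.WithPiTopology

/-! Write `U` for the operator taking the coefficient of `q^n` to that of `q^(2n)`, and `V` for `q ↦
q²`. Everything follows from `U λ = -4 λ - 8 V λ` (`coeff_two_mul_lam`), the Hecke relation at 2 for
the weight 4, level 5 form `η(z)⁴ η(5z)⁴`. Since `U V λ = λ`, iterating gives `U³ λ = -64 V λ`, `U⁵
λ = 256 λ + 512 V λ` and `U⁶ λ = -512 λ - 2048 V λ`; the congruences are read off the coefficients.

The Hecke relation is proved with theta functions instead of modular forms. Gauss's `φ(-q) f_2 =
f_1²` and the dissection `phiNeg_sq` of `φ(-q)²` split `λ` into odd and even parts. The even part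
contains `φ(q^5)² ψ(q²)² + q² φ(q)² ψ(q^10)²` (at `q²`), which is completed to a square by
`f_one_mul_f_five`; the cross term is evaluated by `psi_sq` and Gauss's `ψ(q) f_1 = f_2²`. -/

/-! ### Theta series -/

/-- The series `∑ c_i q^{e_i}` over an arbitrary index type. -/
noncomputable def thetaSeries {ι : Type*} (c : ι → ℤ) (e : ι → ℕ) : ℤ⟦X⟧ :=
  ∑' i, (c i : ℤ⟦X⟧) * X ^ e i

theorem coeff_intCast_mul_X_pow (c : ℤ) (e n : ℕ) :
    coeff n ((c : ℤ⟦X⟧) * X ^ e) = if n = e then c else 0 := by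
  rw [show (c : ℤ⟦X⟧) = C c by simp, coeff_C_mul, coeff_X_pow]
  simp

theorem summable_thetaSeries {ι : Type*} (c : ι → ℤ) {e : ι → ℕ}
    (he : Tendsto e cofinite atTop) : Summable fun i => (c i : ℤ⟦X⟧) * X ^ e i := by
  refine (WithPiTopology.summable_iff_summable_coeff ℤ).mpr fun n => ?_
  refine summable_of_hasFiniteSupport ?_
  have h : {i | ¬ n < e i}.Finite := he.eventually (eventually_gt_atTop n)
  refine h.subset fun i hi => ?_
  simp only [Function.mem_support, coeff_intCast_mul_X_pow] at hi
  grind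

theorem tendsto_add_prod {ι κ : Type*} {e : ι → ℕ} {g : κ → ℕ} (he : Tendsto e cofinite atTop)
    (hg : Tendsto g cofinite atTop) :
    Tendsto (fun p : ι × κ => e p.1 + g p.2) cofinite atTop := by
  refine tendsto_atTop.mpr fun n => ?_
  have h1 : {i | ¬ n ≤ e i}.Finite := he.eventually (eventually_ge_atTop n)
  have h2 : {i | ¬ n ≤ g i}.Finite := hg.eventually (eventually_ge_atTop n)
  refine (h1.prod h2).subset fun p hp => ?_
  simp only [Set.mem_compl_iff, Set.mem_ofPred_eq, Set.mem_prod] at hp ⊢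
  omega

theorem thetaSeries_mul {ι κ : Type*} (c : ι → ℤ) (d : κ → ℤ) {e : ι → ℕ} {g : κ → ℕ}
    (he : Tendsto e cofinite atTop) (hg : Tendsto g cofinite atTop) :
    thetaSeries c e * thetaSeries d g =
      thetaSeries (fun p : ι × κ => c p.1 * d p.2) (fun p => e p.1 + g p.2) := by
  have h := summable_thetaSeries (fun p : ι × κ => c p.1 * d p.2) (tendsto_add_prod he hg)
  have key : ∀ p : ι × κ, (c p.1 : ℤ⟦X⟧) * X ^ e p.1 * ((d p.2 : ℤ⟦X⟧) * X ^ g p.2) =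
      ((c p.1 * d p.2 : ℤ) : ℤ⟦X⟧) * X ^ (e p.1 + g p.2) := fun p => by
    push_cast; ring
  unfold thetaSeries
  rw [(summable_thetaSeries c he).tsum_mul_tsum (summable_thetaSeries d hg)
    (by simpa only [key] using h)]
  exact tsum_congr key

theorem continuous_expand {k : ℕ} (hk : k ≠ 0) :
    Continuous (expand k hk : ℤ⟦X⟧ → ℤ⟦X⟧) := by
  refine continuous_iff_continuousAt.mpr fun φ => ?_
  refine (WithPiTopology.tendsto_iff_coeff_tendsto ℤ _ _ _).mpr fun n => ?_
  simp only [coeff_expand]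
  split_ifs
  · exact (WithPiTopology.continuous_coeff ℤ _).continuousAt
  · exact tendsto_const_nhds

theorem expand_thetaSeries {ι : Type*} {k : ℕ} (hk : k ≠ 0) (c : ι → ℤ) {e : ι → ℕ}
    (he : Tendsto e cofinite atTop) :
    expand k hk (thetaSeries c e) = thetaSeries c (fun i => k * e i) := by
  have h := ((summable_thetaSeries c he).hasSum.map (expand k hk) (continuous_expand hk)).tsum_eq
  rw [thetaSeries, ← h, thetaSeries]
  refine tsum_congr fun i => ?_
  simp [pow_mul]

theorem X_pow_mul_thetaSeries {ι : Type*} (k : ℕ) (c : ι → ℤ) {e : ι → ℕ}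
    (he : Tendsto e cofinite atTop) :
    X ^ k * thetaSeries c e = thetaSeries c (fun i => k + e i) := by
  rw [thetaSeries, ← (summable_thetaSeries c he).tsum_mul_left, thetaSeries]
  refine tsum_congr fun i => ?_
  ring

theorem neg_thetaSeries {ι : Type*} (c : ι → ℤ) (e : ι → ℕ) :
    -thetaSeries c e = thetaSeries (fun i => -c i) e := by
  rw [thetaSeries, ← tsum_neg, thetaSeries]
  refine tsum_congr fun i => ?_
  push_cast; ring

theorem thetaSeries_equiv {ι κ : Type*} (σ : ι ≃ κ) (c : κ → ℤ) (e : κ → ℕ) :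
    thetaSeries (fun i => c (σ i)) (fun i => e (σ i)) = thetaSeries c e :=
  σ.tsum_eq fun j => (c j : ℤ⟦X⟧) * X ^ e j

/-- A theta series is the finite sum of its parts along a partition of the index type. -/
theorem thetaSeries_eq_sum {κ ι γ : Type*} [Fintype κ] {i : κ × ι → γ}
    (hi : Function.Bijective i) (c : γ → ℤ) {e : γ → ℕ} (he : Tendsto e cofinite atTop) :
    thetaSeries c e = ∑ k, thetaSeries (fun a => c (i (k, a))) (fun a => e (i (k, a))) := by
  rw [← thetaSeries_equiv (Equiv.ofBijective i hi), thetaSeries,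
    (summable_thetaSeries _ ?_).tsum_prod' fun k => summable_thetaSeries _ ?_, tsum_fintype]
  · rfl
  · exact he.comp hi.injective.tendsto_cofinite
  · exact he.comp (hi.injective.comp (Prod.mk_right_injective k)).tendsto_cofinite

/-- A theta series with a sign-reversing, exponent-preserving involution vanishes. -/
theorem thetaSeries_eq_zero_of_involution {ι : Type*} (σ : ι ≃ ι) (c : ι → ℤ) (e : ι → ℕ)
    (hc : ∀ i, c (σ i) = -c i) (he : ∀ i, e (σ i) = e i) : thetaSeries c e = 0 := by
  have h := thetaSeries_equiv σ c e
  simp only [hc, he] at h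
  rw [← neg_thetaSeries] at h
  ext n
  have h' : -coeff n (thetaSeries c e) = coeff n (thetaSeries c e) := by
    simpa using congrArg (coeff n) h
  rw [map_zero]
  omega

theorem tendsto_of_natAbs_le {e : ℤ → ℕ} {b : ℕ} (h : ∀ n, n.natAbs ≤ e n + b) :
    Tendsto e cofinite atTop := by
  refine tendsto_atTop.mpr fun n => ?_
  refine (Set.finite_Icc (-(n + b : ℤ)) (n + b)).subset fun a ha => ?_
  have := h a
  simp only [Set.mem_compl_iff, Set.mem_ofPred_eq, Set.mem_Icc] at ha ⊢
  omega

/-! ### The classical theta functions -/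

/-- `φ(q) = ∑_{n ∈ ℤ} q^{n²}`. -/
noncomputable def phi : ℤ⟦X⟧ := thetaSeries (fun _ : ℤ => 1) (fun n => n.natAbs ^ 2)

/-- `φ(-q) = ∑_{n ∈ ℤ} (-1)^n q^{n²}`. -/
noncomputable def phiNeg : ℤ⟦X⟧ :=
  thetaSeries (fun n : ℤ => n.negOnePow) (fun n => n.natAbs ^ 2)

/-- `ψ(q) = ∑_{n ≥ 0} q^{n(n+1)/2}`. -/
noncomputable def psi : ℤ⟦X⟧ := thetaSeries (fun _ : ℕ => 1) (fun n => n * (n + 1) / 2)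

/-- The triangular number `n(n+1)/2` of an integer `n`. -/
def triangular (n : ℤ) : ℕ := (n * (n + 1) / 2).toNat

theorem two_mul_triangular (n : ℤ) : 2 * (triangular n : ℤ) = n * (n + 1) := by
  have h : 0 ≤ n * (n + 1) := by
    rcases le_or_gt 0 n with h | h <;> nlinarith
  have h2 : (2 : ℤ) ∣ n * (n + 1) := (Int.even_mul_succ_self n).two_dvd
  rw [triangular]
  omega

theorem tendsto_sq : Tendsto (fun n : ℤ => n.natAbs ^ 2) cofinite atTop :=
  tendsto_of_natAbs_le (b := 0) fun n => by nlinarith [Nat.le_self_pow two_ne_zero n.natAbs]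

theorem tendsto_triangular : Tendsto triangular cofinite atTop :=
  tendsto_of_natAbs_le (b := 1) fun n => by
    have := two_mul_triangular n
    zify
    rcases abs_cases n with ⟨h, h'⟩ | ⟨h, h'⟩ <;> rw [h] <;> nlinarith

theorem tendsto_pentagonal : Tendsto pentagonal cofinite atTop :=
  Nat.cofinite_eq_atTop ▸ pentagonal_injective.tendsto_cofinite

/-- The reflection `n ↦ -n - 1` preserves triangular numbers. Summing over all of `ℤ` makes linear
changes of variables available. -/
theorem two_mul_psi : 2 * psi = thetaSeries (fun _ : ℤ => 1) triangular := by
  let i : Fin 2 × ℕ → ℤ := fun p => if p.1 = 0 then p.2 else -p.2 - 1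
  have hi : Function.Bijective i := by
    constructor
    · rintro ⟨k, a⟩ ⟨l, b⟩ h
      fin_cases k <;> fin_cases l <;> simp [i] at h ⊢ <;> omega
    · intro n
      rcases le_or_gt 0 n with h | h
      · exact ⟨(0, n.toNat), by simp [i, h]⟩
      · exact ⟨(1, (-n - 1).toNat), by simp [i]; omega⟩
  rw [thetaSeries_eq_sum hi _ tendsto_triangular, Fin.sum_univ_two, two_mul, psi]
  have key (n : ℕ) : 2 * (n * (n + 1) / 2) = n * (n + 1) :=
    Nat.mul_div_cancel' (Nat.even_mul_succ_self n).two_dvd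
  congr 2
  funext n
  have h1 := key n
  have h2 := two_mul_triangular (-n - 1)
  zify at h1
  zify
  simp only [i, one_ne_zero, if_false]
  grind

/-! ### Gauss's product formulas for `φ(-q)` and `ψ(q)` -/

/-- Supplies the quotients of Pochhammer symbols in Gauss's finite identities without division:
`(-1; q)_j / (q; q)_j` for `φ`, `(q; q²)_j / (q²; q²)_j` for `ψ`. -/
theorem exists_ratio_sequence {R : Type*} [CommRing R] (u v : ℕ → R) (hu : ∀ j, IsUnit (u j)) :
    ∃ a : ℕ → R, a 0 = 1 ∧ ∀ j, a (j + 1) * u j = a j * v j := by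
  choose w hw using fun j => (hu j).exists_left_inv
  refine ⟨fun n => ∏ j ∈ Finset.range n, v j * w j, by simp, fun j => ?_⟩
  simp only [Finset.prod_range_succ]
  linear_combination (∏ j ∈ Finset.range j, v j * w j) * v j * hw j

theorem isUnit_one_sub_X_pow {k : ℕ} (hk : k ≠ 0) : IsUnit (1 - X ^ k : ℤ⟦X⟧) := by
  rw [isUnit_iff_constantCoeff]
  simp [hk]

/-- A finite form of Gauss's formula for `φ(-q)`. -/
theorem gauss_square_finite {R : Type*} [CommRing R] (q : R) (a : ℕ → R) (h0 : a 0 = 1)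
    (ha : ∀ j, a (j + 1) * (1 - q ^ (j + 1)) = a j * (1 + q ^ j)) (n : ℕ) :
    (1 + 2 * ∑ s ∈ Finset.range n, (-1) ^ (s + 1) * q ^ (s + 1) ^ 2) *
        ∏ i ∈ Finset.range n, (1 + q ^ (i + 1)) =
      (∏ i ∈ Finset.range n, (1 - q ^ (i + 1))) *
        ∑ j ∈ Finset.range (n + 1), (-1) ^ j * q ^ (j * (n + 1)) * a j := by
  have hprod (n : ℕ) : (∏ i ∈ Finset.range (n + 1), (1 - q ^ (i + 1))) * a (n + 1) =
      2 * ∏ i ∈ Finset.range n, (1 + q ^ (i + 1)) := by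
    induction n with
    | zero =>
      have := ha 0
      simp [h0] at this ⊢
      linear_combination this
    | succ n ih =>
      rw [Finset.prod_range_succ, Finset.prod_range_succ (fun i => 1 + q ^ (i + 1))]
      linear_combination (∏ i ∈ Finset.range (n + 1), (1 - q ^ (i + 1))) * ha (n + 1) +
        (1 + q ^ (n + 1)) * ih
  -- With `m = n + 1`, this telescoping sum links the right-hand sums for `n` and `n + 1`.
  have htel (m J : ℕ) : ∑ j ∈ Finset.range J,
      (-1) ^ j * a j * q ^ (j * m) * ((1 - q ^ m) * q ^ j - (1 + q ^ m)) =
        (-1) ^ J * q ^ (J * m) * (1 - q ^ J) * a J := by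
    induction J with
    | zero => simp
    | succ J ih =>
      rw [Finset.sum_range_succ, ih]
      linear_combination (-1) ^ J * q ^ ((J + 1) * m) * ha J
  induction n with
  | zero => simp [h0]
  | succ n ih =>
    have hsum := htel (n + 1) (n + 1)
    have hsplit : ∑ j ∈ Finset.range (n + 1),
        (-1) ^ j * a j * q ^ (j * (n + 1)) * ((1 - q ^ (n + 1)) * q ^ j - (1 + q ^ (n + 1))) =
        (1 - q ^ (n + 1)) * ∑ j ∈ Finset.range (n + 1), (-1) ^ j * q ^ (j * (n + 1 + 1)) * a j -
        (1 + q ^ (n + 1)) * ∑ j ∈ Finset.range (n + 1), (-1) ^ j * q ^ (j * (n + 1)) * a j := by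
      rw [Finset.mul_sum, Finset.mul_sum, ← Finset.sum_sub_distrib]
      exact Finset.sum_congr rfl fun j _ => by ring
    rw [hsplit] at hsum
    have hp := hprod n
    rw [Finset.prod_range_succ] at hp
    rw [Finset.sum_range_succ, Finset.prod_range_succ, Finset.prod_range_succ,
      Finset.sum_range_succ _ (n + 1)]
    linear_combination (1 + q ^ (n + 1)) * ih -
      (∏ i ∈ Finset.range n, (1 - q ^ (i + 1))) * hsum -
      (-1) ^ (n + 1) * q ^ (n + 1) ^ 2 * (1 + q ^ (n + 1)) * hp

/-- A finite form of Gauss's formula for `ψ(q)`. -/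
theorem gauss_triangular_finite {R : Type*} [CommRing R] (q : R) (b : ℕ → R) (h0 : b 0 = 1)
    (hb : ∀ j, b (j + 1) * (1 - q ^ (2 * j + 2)) = b j * (1 - q ^ (2 * j + 1))) (n : ℕ) :
    (∑ s ∈ Finset.range (2 * n), q ^ (s * (s + 1) / 2)) *
        ∏ i ∈ Finset.range n, (1 - q ^ (2 * i + 1)) =
      (∏ i ∈ Finset.range n, (1 - q ^ (2 * i + 2))) *
        ∑ s ∈ Finset.range n, q ^ (s * (2 * n + 1)) * b s := by
  have hprod (n : ℕ) : (∏ i ∈ Finset.range n, (1 - q ^ (2 * i + 2))) * b n =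
      ∏ i ∈ Finset.range n, (1 - q ^ (2 * i + 1)) := by
    induction n with
    | zero => simp [h0]
    | succ n ih =>
      rw [Finset.prod_range_succ, Finset.prod_range_succ]
      linear_combination (∏ i ∈ Finset.range n, (1 - q ^ (2 * i + 2))) * hb n +
        (1 - q ^ (2 * n + 1)) * ih
  -- The same telescoping device, again linking the right-hand sums for `n` and `n + 1`.
  have htel (n J : ℕ) : ∑ s ∈ Finset.range J, q ^ (s * (2 * n + 1)) * b s *
      ((1 - q ^ (2 * n + 2)) * q ^ (2 * s) - (1 - q ^ (2 * n + 1))) =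
        q ^ (J * (2 * n + 1)) * (1 - q ^ (2 * J)) * b J := by
    induction J with
    | zero => simp
    | succ J ih =>
      rw [Finset.sum_range_succ, ih]
      linear_combination -q ^ ((J + 1) * (2 * n + 1)) * hb J
  induction n with
  | zero => simp
  | succ n ih =>
    have hsum := htel n n
    have hsplit : ∑ s ∈ Finset.range n, q ^ (s * (2 * n + 1)) * b s *
        ((1 - q ^ (2 * n + 2)) * q ^ (2 * s) - (1 - q ^ (2 * n + 1))) =
        (1 - q ^ (2 * n + 2)) * ∑ s ∈ Finset.range n, q ^ (s * (2 * (n + 1) + 1)) * b s -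
        (1 - q ^ (2 * n + 1)) * ∑ s ∈ Finset.range n, q ^ (s * (2 * n + 1)) * b s := by
      rw [Finset.mul_sum, Finset.mul_sum, ← Finset.sum_sub_distrib]
      exact Finset.sum_congr rfl fun j _ => by ring
    rw [hsplit] at hsum
    have hp := hprod n
    have e1 : 2 * n * (2 * n + 1) / 2 = n * (2 * n + 1) := by
      rw [mul_assoc, Nat.mul_div_cancel_left _ two_pos]
    have e2 : (2 * n + 1) * (2 * n + 1 + 1) / 2 = (2 * n + 1) * (n + 1) := by
      rw [show (2 * n + 1) * (2 * n + 1 + 1) = 2 * ((2 * n + 1) * (n + 1)) by ring,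
        Nat.mul_div_cancel_left _ two_pos]
    rw [show 2 * (n + 1) = 2 * n + 1 + 1 by ring, Finset.sum_range_succ, Finset.sum_range_succ,
      Finset.prod_range_succ, Finset.prod_range_succ, Finset.sum_range_succ _ n, e1, e2]
    rw [show 2 * (n + 1) = 2 * n + 1 + 1 by ring] at hsum
    linear_combination (1 - q ^ (2 * n + 1)) * ih -
      (∏ i ∈ Finset.range n, (1 - q ^ (2 * i + 2))) * hsum -
      q ^ (n * (2 * n + 1)) * (1 - q ^ (2 * n + 1)) * (1 + q ^ (2 * n + 1)) * hp

theorem tendsto_prod_f_one :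
    Tendsto (fun n => ∏ i ∈ Finset.range n, (1 - X ^ (i + 1) : ℤ⟦X⟧)) atTop (𝓝 (f 1)) := by
  have h := (hasProd_f one_pos).tendsto_prod_nat
  simpa [← pow_succ'] using h

theorem f_eq_expand {k : ℕ} (hk : k ≠ 0) : f k = expand k hk (f 1) := by
  have h := (hasProd_f one_pos).map (expand k hk) (continuous_expand hk)
  refine (hasProd_f (Nat.pos_of_ne_zero hk)).unique ?_
  convert h using 2
  simp

theorem f_one_eq_thetaSeries : f 1 = thetaSeries (fun n : ℤ => n.negOnePow) pentagonal := by
  have h1 : f 1 = pentagonalSeries ℤ := by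
    refine (hasProd_f one_pos).unique ?_
    simpa [← pow_succ'] using WithPiTopology.hasProd_one_sub_X_pow ℤ
  rw [h1, WithPiTopology.pentagonalSeries_eq_tsum]
  rfl

/-- Two convergent sequences that agree to higher and higher order have the same limit. -/
theorem eq_of_tendsto_of_dvd_sub {u v : ℕ → ℤ⟦X⟧} {a b : ℤ⟦X⟧} (hu : Tendsto u atTop (𝓝 a))
    (hv : Tendsto v atTop (𝓝 b)) (h : ∀ n, X ^ n ∣ u n - v n) : a = b := by
  ext d
  have hu' := (WithPiTopology.tendsto_iff_coeff_tendsto ℤ _ _ _).mp hu d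
  have hv' := (WithPiTopology.tendsto_iff_coeff_tendsto ℤ _ _ _).mp hv d
  refine tendsto_nhds_unique hu' (hv'.congr' ?_)
  filter_upwards [eventually_gt_atTop d] with n hn
  have := X_pow_dvd_iff.mp (h n) d hn
  rw [map_sub] at this
  omega

/-- Gauss: `φ(-q) f_2 = f_1²`. -/
theorem phiNeg_mul : phiNeg * expand 2 two_ne_zero (f 1) = f 1 ^ 2 := by
  obtain ⟨a, h0, ha⟩ := exists_ratio_sequence (fun j => (1 - X ^ (j + 1) : ℤ⟦X⟧))
    (fun j => 1 + X ^ j) fun j => isUnit_one_sub_X_pow j.succ_ne_zero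
  have hS : Tendsto (fun n => 1 + 2 * ∑ s ∈ Finset.range n, (-1) ^ (s + 1) * X ^ (s + 1) ^ 2)
      atTop (𝓝 phiNeg) := by
    have h : HasSum _ phiNeg :=
      (summable_thetaSeries (fun n : ℤ => n.negOnePow) tendsto_sq).hasSum
    -- Pairing `n` with `-n` counts the term at 0 twice, hence the subtraction of 1.
    have h2 := (h.nat_add_neg.tendsto_sum_nat.comp (tendsto_add_atTop_nat 1)).sub_const 1
    refine Tendsto.congr (fun n => ?_) (by simpa using h2)
    rw [Finset.sum_range_succ', Finset.mul_sum]
    simp only [← two_mul]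
    simp
    ring
  have hf2 := ((continuous_expand two_ne_zero).tendsto (f 1)).comp tendsto_prod_f_one
  refine eq_of_tendsto_of_dvd_sub (hS.mul hf2) (tendsto_prod_f_one.pow 2) fun n => ?_
  have key := gauss_square_finite X a h0 ha n
  have hM : (expand 2 two_ne_zero ∘ fun n => ∏ i ∈ Finset.range n, (1 - X ^ (i + 1) : ℤ⟦X⟧)) n =
      (∏ i ∈ Finset.range n, (1 - X ^ (i + 1))) * ∏ i ∈ Finset.range n, (1 + X ^ (i + 1)) := by
    rw [← Finset.prod_mul_distrib, Function.comp_apply, map_prod]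
    refine Finset.prod_congr rfl fun i _ => ?_
    simp
    ring
  -- Only the `j = 0` term, equal to 1, survives in the limit.
  have hR : X ^ n ∣ ∑ j ∈ Finset.range n, (-1) ^ (j + 1) * X ^ ((j + 1) * (n + 1)) * a (j + 1) :=
    Finset.dvd_sum fun j _ => Dvd.dvd.mul_right (Dvd.dvd.mul_left (pow_dvd_pow _ (by nlinarith)) _) _
  rw [Finset.sum_range_succ'] at key
  rw [hM]
  convert hR.mul_left ((∏ i ∈ Finset.range n, (1 - X ^ (i + 1))) ^ 2) using 1
  simp only [h0] at key
  linear_combination (∏ i ∈ Finset.range n, (1 - X ^ (i + 1))) * key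

/-- Gauss: `ψ(q) f_1 = f_2²`. -/
theorem psi_mul : psi * f 1 = expand 2 two_ne_zero (f 1) ^ 2 := by
  obtain ⟨b, h0, hb⟩ := exists_ratio_sequence (fun j => (1 - X ^ (2 * j + 2) : ℤ⟦X⟧))
    (fun j => 1 - X ^ (2 * j + 1)) fun j => isUnit_one_sub_X_pow (Nat.succ_ne_zero _)
  have h2n : Tendsto (fun n : ℕ => 2 * n) atTop atTop :=
    tendsto_id.const_mul_atTop' two_pos
  have hT : Tendsto (fun n => ∑ s ∈ Finset.range (2 * n), (X : ℤ⟦X⟧) ^ (s * (s + 1) / 2))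
      atTop (𝓝 psi) := by
    have he : Tendsto (fun n => n * (n + 1) / 2) cofinite atTop := by
      rw [Nat.cofinite_eq_atTop]
      refine tendsto_atTop_mono (fun n => ?_) tendsto_id
      rw [Nat.le_div_iff_mul_le two_pos, id]
      rcases n with _ | n
      · simp
      · nlinarith
    have h : HasSum _ psi := (summable_thetaSeries (fun _ : ℕ => 1) he).hasSum
    simpa [Function.comp_def] using h.tendsto_sum_nat.comp h2n
  have hf2 := ((continuous_expand two_ne_zero).tendsto (f 1)).comp tendsto_prod_f_one
  refine eq_of_tendsto_of_dvd_sub (hT.mul (tendsto_prod_f_one.comp h2n)) (hf2.pow 2) fun n => ?_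
  have key := gauss_triangular_finite X b h0 hb n
  have hM : (expand 2 two_ne_zero ∘ fun n => ∏ i ∈ Finset.range n, (1 - X ^ (i + 1) : ℤ⟦X⟧)) n =
      ∏ i ∈ Finset.range n, (1 - X ^ (2 * i + 2)) := by
    rw [Function.comp_apply, map_prod]
    refine Finset.prod_congr rfl fun i _ => ?_
    simp
    ring
  have hN : ∏ i ∈ Finset.range (2 * n), (1 - X ^ (i + 1) : ℤ⟦X⟧) =
      (∏ i ∈ Finset.range n, (1 - X ^ (2 * i + 1))) *
        ∏ i ∈ Finset.range n, (1 - X ^ (2 * i + 2)) := by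
    clear key hM
    induction n with
    | zero => simp
    | succ n ih =>
      rw [show 2 * (n + 1) = 2 * n + 1 + 1 by ring, Finset.prod_range_succ,
        Finset.prod_range_succ, ih, Finset.prod_range_succ, Finset.prod_range_succ]
      ring
  rw [hM, Function.comp_apply, hN]
  -- For `n = 0` the sum over `s` is empty and lacks its leading 1, but divisibility by `X ^ 0` is
  -- trivial.
  rcases n with _ | n
  · simp
  have hR : X ^ (n + 1) ∣
      ∑ s ∈ Finset.range n, X ^ ((s + 1) * (2 * (n + 1) + 1)) * b (s + 1) :=
    Finset.dvd_sum fun s _ => Dvd.dvd.mul_right (pow_dvd_pow _ (by nlinarith)) _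
  rw [Finset.sum_range_succ' _ n] at key
  convert hR.mul_left ((∏ i ∈ Finset.range (n + 1), (1 - X ^ (2 * i + 2))) ^ 2) using 1
  simp only [h0] at key
  linear_combination (∏ i ∈ Finset.range (n + 1), (1 - X ^ (2 * i + 2))) * key

/-! ### Theta function identities -/

theorem bijective_parity_diagonal :
    Function.Bijective fun p : Fin 2 × (ℤ × ℤ) =>
      ((p.2.1 + p.2.2 + (p.1 : ℤ), p.2.1 - p.2.2) : ℤ × ℤ) := by
  constructor
  · rintro ⟨k, s, t⟩ ⟨l, s', t'⟩ h
    fin_cases k <;> fin_cases l <;> simp at h ⊢ <;> omega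
  · rintro ⟨a, b⟩
    rcases Int.even_or_odd' (a + b) with ⟨c, h | h⟩
    · exact ⟨(0, c, c - b), by simp; omega⟩
    · exact ⟨(1, c, c - b), by simp; omega⟩

theorem bijective_parity_snd :
    Function.Bijective fun p : Fin 2 × (ℤ × ℤ) => ((p.2.1, 2 * p.2.2 + (p.1 : ℤ)) : ℤ × ℤ) := by
  constructor
  · rintro ⟨k, s, t⟩ ⟨l, s', t'⟩ h
    fin_cases k <;> fin_cases l <;> simp at h ⊢ <;> omega
  · rintro ⟨a, b⟩
    rcases Int.even_or_odd' b with ⟨c, h | h⟩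
    · exact ⟨(0, a, c), by simp; omega⟩
    · exact ⟨(1, a, c), by simp; omega⟩

theorem bijective_mod_three_fst :
    Function.Bijective fun p : Fin 3 × (ℤ × ℤ) => ((3 * p.2.1 + (p.1 : ℤ), p.2.2) : ℤ × ℤ) := by
  constructor
  · rintro ⟨k, s, t⟩ ⟨l, s', t'⟩ h
    fin_cases k <;> fin_cases l <;> simp at h ⊢ <;> omega
  · rintro ⟨a, b⟩
    have h : a % 3 = 0 ∨ a % 3 = 1 ∨ a % 3 = 2 := by omega
    rcases h with h | h | h
    · exact ⟨(0, a / 3, b), by simp; omega⟩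
    · exact ⟨(1, a / 3, b), by simp; omega⟩
    · exact ⟨(2, a / 3, b), by simp; omega⟩

theorem tendsto_const_mul {ι : Type*} {e : ι → ℕ} (he : Tendsto e cofinite atTop) {k : ℕ}
    (hk : k ≠ 0) : Tendsto (fun i => k * e i) cofinite atTop :=
  tendsto_atTop_mono (fun i => Nat.le_mul_of_pos_left (e i) (Nat.pos_of_ne_zero hk)) he

theorem two_mul_expand_psi {k : ℕ} (hk : k ≠ 0) :
    2 * expand k hk psi = thetaSeries (fun _ : ℤ => 1) (fun n => k * triangular n) := by
  rw [← expand_thetaSeries hk _ tendsto_triangular, ← two_mul_psi, map_mul, map_ofNat]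

theorem thetaSeries_congr {ι : Type*} {c c' : ι → ℤ} {e e' : ι → ℕ} (hc : ∀ i, c i = c' i)
    (he : ∀ i, (e i : ℤ) = e' i) : thetaSeries c e = thetaSeries c' e' := by
  rw [funext hc, funext fun i => Nat.cast_injective (he i)]

theorem thetaSeries_congr_equiv {ι κ : Type*} (σ : ι ≃ κ) {c : ι → ℤ} {c' : κ → ℤ} {e : ι → ℕ}
    {e' : κ → ℕ} (hc : ∀ i, c i = c' (σ i)) (he : ∀ i, (e i : ℤ) = e' (σ i)) :
    thetaSeries c e = thetaSeries c' e' :=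
  (thetaSeries_congr hc he).trans (thetaSeries_equiv σ c' e')

/-- Split the pairs `(m, n)` by the parity of `m + n`, which is also the sign. With `m = s + t + k`,
`n = s - t`, the form `m² + n²` becomes `2s² + 2t²` for `k = 0` and `1 + 4T(s) + 4T(t)` for `k = 1`,
where `T` is `triangular`. -/
theorem phiNeg_sq :
    phiNeg ^ 2 = expand 2 two_ne_zero phi ^ 2 - 4 * X * expand 4 four_ne_zero psi ^ 2 := by
  have h4 := two_mul_expand_psi four_ne_zero
  have e4 : 4 * X * expand 4 four_ne_zero psi ^ 2 =
      X ^ 1 * ((2 * expand 4 four_ne_zero psi) * (2 * expand 4 four_ne_zero psi)) := by ring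
  have t4 := tendsto_const_mul tendsto_triangular four_ne_zero
  have t2 := tendsto_const_mul tendsto_sq two_ne_zero
  rw [e4, h4, thetaSeries_mul _ _ t4 t4, X_pow_mul_thetaSeries _ _ (tendsto_add_prod t4 t4), phi,
    phiNeg, expand_thetaSeries _ _ tendsto_sq, sq, sq, thetaSeries_mul _ _ t2 t2,
    thetaSeries_mul _ _ tendsto_sq tendsto_sq,
    thetaSeries_eq_sum bijective_parity_diagonal _ (tendsto_add_prod tendsto_sq tendsto_sq),
    Fin.sum_univ_two, sub_eq_add_neg, neg_thetaSeries]
  congr 1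
  · refine thetaSeries_congr (fun p => ?_) fun p => ?_
    · rw [← Units.val_mul, ← Int.negOnePow_add, Int.negOnePow_even _ ⟨p.1, by simp⟩]
      simp
    · push_cast
      simp only [Fin.val_zero, Nat.cast_zero, sq_abs]
      ring
  · refine thetaSeries_congr (fun p => ?_) fun p => ?_
    · rw [← Units.val_mul, ← Int.negOnePow_add,
        Int.negOnePow_odd _ ⟨p.1, by simp only [Fin.val_one, Nat.cast_one]; ring⟩]
      simp
    · have := two_mul_triangular p.1
      have := two_mul_triangular p.2
      push_cast
      simp only [Fin.val_one, Nat.cast_one, sq_abs]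
      linarith

/-- The same substitution gives `T(s+t) + T(s-t) = t² + 2T(s)` and `T(s+t+1) + T(s-t) = (s+1)² +
2T(t)`, so both parity classes contribute the same series. -/
theorem psi_sq : psi ^ 2 = phi * expand 2 two_ne_zero psi := by
  have h2 := two_mul_expand_psi two_ne_zero
  have t2 := tendsto_const_mul tendsto_triangular two_ne_zero
  have key : (2 * psi) * (2 * psi) = 2 * (phi * (2 * expand 2 two_ne_zero psi)) := by
    rw [h2, two_mul_psi, phi, thetaSeries_mul _ _ tendsto_sq t2,
      thetaSeries_mul _ _ tendsto_triangular tendsto_triangular,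
      thetaSeries_eq_sum bijective_parity_diagonal _
        (tendsto_add_prod tendsto_triangular tendsto_triangular),
      Fin.sum_univ_two, two_mul]
    congr 1
    · refine thetaSeries_congr_equiv (Equiv.prodComm ℤ ℤ)
        (fun p => rfl) fun p => ?_
      have h1 := two_mul_triangular (p.1 + p.2 + ((0 : Fin 2) : ℕ))
      have h2 := two_mul_triangular (p.1 - p.2)
      have h3 := two_mul_triangular p.1
      simp only [Fin.val_zero, Nat.cast_zero] at h1
      simp only [Equiv.prodComm_apply, Prod.fst_swap, Prod.snd_swap, Fin.val_zero, Nat.cast_zero]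
      push_cast
      simp only [sq_abs]
      linarith
    · refine thetaSeries_congr_equiv ((Equiv.addRight (1 : ℤ)).prodCongr (Equiv.refl ℤ))
        (fun p => rfl) fun p => ?_
      have h1 := two_mul_triangular (p.1 + p.2 + ((1 : Fin 2) : ℕ))
      have h2 := two_mul_triangular (p.1 - p.2)
      have h3 := two_mul_triangular p.2
      simp only [Fin.val_one, Nat.cast_one] at h1
      simp only [Equiv.prodCongr_apply, Prod.map_fst, Prod.map_snd, Equiv.coe_addRight,
        Equiv.refl_apply, Fin.val_one, Nat.cast_one]
      push_cast
      simp only [sq_abs]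
      linarith
  ext n
  have h := congrArg (coeff n) (show 4 * psi ^ 2 = 4 * (phi * expand 2 two_ne_zero psi) by
    linear_combination key)
  rw [show (4 : ℤ⟦X⟧) = C (4 : ℤ) by simp, coeff_C_mul, coeff_C_mul] at h
  omega

/-- The exponent `w² + w - wt + t(3t-1)/2`. -/
def mixedExponent (p : ℤ × ℤ) : ℕ := (p.1 ^ 2 + p.1 - p.1 * p.2 + pentagonal p.2).toNat

theorem two_mul_mixedExponent (w t : ℤ) :
    2 * (mixedExponent (w, t) : ℤ) = 2 * w ^ 2 + 2 * w - 2 * w * t + 3 * t ^ 2 - t := by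
  have h := two_mul_natCast_pentagonal t
  have h0 : 0 ≤ w ^ 2 + w - w * t + pentagonal t := by
    -- Four times the exponent plus 1 is `(2w + 1 - t)² + 5t²`; integrality then gives
    -- nonnegativity.
    have : -1 ≤ 4 * (w ^ 2 + w - w * t + pentagonal t) := by
      nlinarith [sq_nonneg (2 * w + 1 - t), sq_nonneg t]
    omega
  rw [mixedExponent, Int.toNat_of_nonneg h0]
  linarith

theorem tendsto_mixedExponent : Tendsto mixedExponent cofinite atTop := by
  refine tendsto_atTop.mpr fun n => ?_
  refine ((Set.finite_Icc (-(2 * n + 2 : ℤ)) (2 * n + 2)).prod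
    (Set.finite_Icc (-(2 * n + 2 : ℤ)) (2 * n + 2))).subset ?_
  rintro ⟨w, t⟩ hp
  have h := two_mul_mixedExponent w t
  simp only [Set.mem_compl_iff, Set.mem_ofPred_eq, not_le, Set.mem_prod, Set.mem_Icc] at hp ⊢
  zify at hp
  have h1 : (2 * w + 1 - t) ^ 2 + 5 * t ^ 2 = 4 * mixedExponent (w, t) + 1 := by linarith
  -- The difference of the two sides is the square `(2w + 1 - 6t)²`.
  have h2 : 5 * (2 * w + 1) ^ 2 ≤ 6 * (4 * mixedExponent (w, t) + 1) := by
    nlinarith [sq_nonneg (2 * w + 1 - 6 * t)]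
  refine ⟨⟨?_, ?_⟩, ?_, ?_⟩ <;> nlinarith

/-- `f_1 f_5 = φ(q^5) ψ(q^2) - q φ(q) ψ(q^10)`. -/
theorem f_one_mul_f_five :
    f 1 * expand 5 (by decide) (f 1) =
      expand 5 (by decide) phi * expand 2 two_ne_zero psi -
        X * phi * expand 10 (by decide) psi := by
  have h5 : (5 : ℕ) ≠ 0 := by decide
  have h10 : (10 : ℕ) ≠ 0 := by decide
  have t2 := tendsto_const_mul tendsto_triangular two_ne_zero
  have t10 := tendsto_const_mul tendsto_triangular h10
  have tp := tendsto_const_mul tendsto_pentagonal h5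
  have ts := tendsto_const_mul tendsto_sq h5
  have tm := tendsto_mixedExponent
  have even0 (a : ℤ) : ((2 * a).negOnePow : ℤ) = 1 := by
    rw [Int.negOnePow_even _ (even_two_mul a), Units.val_one]
  have odd0 (a : ℤ) : ((2 * a + 1).negOnePow : ℤ) = -1 := by
    rw [Int.negOnePow_odd _ ⟨a, rfl⟩]; simp
  -- The sum of `(-1)^t q^(mixedExponent (w, t))` is computed in two ways. Here by the parity of
  -- `t`: the exponent is `5s² + 2T(w-s)` for `t = 2s` and `1 + (w-s)² + 10T(s)` for `t = 2s + 1`.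
  have byParity : thetaSeries (fun p : ℤ × ℤ => p.2.negOnePow) mixedExponent =
      expand 5 h5 phi * (2 * expand 2 two_ne_zero psi) -
        X ^ 1 * (phi * (2 * expand 10 h10 psi)) := by
    rw [two_mul_expand_psi, two_mul_expand_psi, phi, expand_thetaSeries _ _ tendsto_sq,
      thetaSeries_mul _ _ ts t2, thetaSeries_mul _ _ tendsto_sq t10,
      X_pow_mul_thetaSeries _ _ (tendsto_add_prod tendsto_sq t10), sub_eq_add_neg, neg_thetaSeries,
      thetaSeries_eq_sum bijective_parity_snd _ tm, Fin.sum_univ_two]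
    congr 1
    · refine thetaSeries_congr_equiv (⟨fun p => (p.2, p.1 - p.2), fun p => (p.1 + p.2, p.1),
        fun p => by simp, fun p => by simp⟩ : ℤ × ℤ ≃ ℤ × ℤ)
        (fun p => ?_) fun p => ?_
      · simp
      · have h1 := two_mul_mixedExponent p.1 (2 * p.2 + ((0 : Fin 2) : ℕ))
        have h2 := two_mul_triangular (p.1 - p.2)
        simp only [Fin.val_zero, Nat.cast_zero] at h1
        simp only [Equiv.coe_fn_mk, Fin.val_zero, Nat.cast_zero]
        push_cast
        simp only [sq_abs]
        linarith
    · refine thetaSeries_congr_equiv (⟨fun p => (p.1 - p.2, p.2), fun p => (p.1 + p.2, p.2),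
        fun p => by simp, fun p => by simp⟩ : ℤ × ℤ ≃ ℤ × ℤ)
        (fun p => ?_) fun p => ?_
      · simp
      · have h1 := two_mul_mixedExponent p.1 (2 * p.2 + ((1 : Fin 2) : ℕ))
        have h2 := two_mul_triangular p.2
        simp only [Fin.val_one, Nat.cast_one] at h1
        simp only [Equiv.coe_fn_mk, Fin.val_one, Nat.cast_one]
        push_cast
        simp only [sq_abs]
        linarith
  -- Now by `w` modulo 3: residues 0 and 2 each give `f_1 f_5`, and residue 1 cancels.
  have byMod : thetaSeries (fun p : ℤ × ℤ => p.2.negOnePow) mixedExponent =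
      2 * (f 1 * expand 5 h5 (f 1)) := by
    have hF := thetaSeries_mul (fun n : ℤ => n.negOnePow) (fun n : ℤ => n.negOnePow)
      tendsto_pentagonal tp
    rw [f_one_eq_thetaSeries, expand_thetaSeries h5 _ tendsto_pentagonal, hF,
      thetaSeries_eq_sum bijective_mod_three_fst _ tm, Fin.sum_univ_three]
    -- For fixed `w` the exponent is symmetric under `t ↦ (2w + 1)/3 - t`. At `w = 3a + 1` this is
    -- `t ↦ 2a + 1 - t`, which flips the parity of `t` and hence the sign.
    have middle : thetaSeries (fun a : ℤ × ℤ => (a.2.negOnePow : ℤ))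
        (fun a => mixedExponent (3 * a.1 + ((1 : Fin 3) : ℕ), a.2)) = 0 := by
      refine thetaSeries_eq_zero_of_involution (⟨fun p => (p.1, 2 * p.1 + 1 - p.2),
        fun p => (p.1, 2 * p.1 + 1 - p.2), fun p => by simp, fun p => by simp⟩ : ℤ × ℤ ≃ ℤ × ℤ)
        _ _ (fun p => ?_) fun p => ?_
      · simp only [Equiv.coe_fn_mk]
        rw [Int.negOnePow_sub, Units.val_mul, odd0, neg_one_mul]
      · have h1 := two_mul_mixedExponent (3 * p.1 + ((1 : Fin 3) : ℕ)) p.2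
        have h2 := two_mul_mixedExponent (3 * p.1 + ((1 : Fin 3) : ℕ)) (2 * p.1 + 1 - p.2)
        simp only [Fin.val_one, Nat.cast_one] at h1 h2
        simp only [Equiv.coe_fn_mk, Fin.val_one, Nat.cast_one]
        zify
        linarith
    rw [middle, add_zero, two_mul]
    congr 1
    · refine thetaSeries_congr_equiv (⟨fun p => (p.2 - p.1, -p.1), fun p => (-p.2, p.1 - p.2),
        fun p => by simp, fun p => by simp⟩ : ℤ × ℤ ≃ ℤ × ℤ)
        (fun p => ?_) fun p => ?_
      · simp only [Equiv.coe_fn_mk]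
        rw [← Units.val_mul, ← Int.negOnePow_add,
          show p.2 - p.1 + -p.1 = p.2 - 2 * p.1 by ring, Int.negOnePow_sub, Units.val_mul, even0,
          mul_one]
      · have h1 := two_mul_mixedExponent (3 * p.1 + ((0 : Fin 3) : ℕ)) p.2
        have h2 := two_mul_natCast_pentagonal (p.2 - p.1)
        have h3 := two_mul_natCast_pentagonal (-p.1)
        simp only [Fin.val_zero, Nat.cast_zero] at h1
        simp only [Equiv.coe_fn_mk, Fin.val_zero, Nat.cast_zero]
        push_cast
        linarith
    · refine thetaSeries_congr_equiv (⟨fun p => (p.1 + 1 - p.2, p.1 + 1), fun p => (p.2 - 1, p.2 - p.1),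
        fun p => by simp, fun p => by simp⟩ : ℤ × ℤ ≃ ℤ × ℤ)
        (fun p => ?_) fun p => ?_
      · simp only [Equiv.coe_fn_mk]
        rw [← Units.val_mul, ← Int.negOnePow_add,
          show p.1 + 1 - p.2 + (p.1 + 1) = 2 * (p.1 + 1) - p.2 by ring, Int.negOnePow_sub,
          Units.val_mul, even0, one_mul]
      · have h1 := two_mul_mixedExponent (3 * p.1 + ((2 : Fin 3) : ℕ)) p.2
        have h2 := two_mul_natCast_pentagonal (p.1 + 1 - p.2)
        have h3 := two_mul_natCast_pentagonal (p.1 + 1)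
        simp only [Fin.val_two, Nat.cast_ofNat] at h1
        simp only [Equiv.coe_fn_mk, Fin.val_two, Nat.cast_ofNat]
        push_cast
        linarith
  ext n
  have h := congrArg (coeff n) (byMod.symm.trans byParity)
  rw [show expand 5 h5 phi * (2 * expand 2 two_ne_zero psi) -
        X ^ 1 * (phi * (2 * expand 10 h10 psi)) = 2 * (expand 5 h5 phi * expand 2 two_ne_zero psi -
        X * phi * expand 10 h10 psi) by ring,
    show (2 : ℤ⟦X⟧) = C (2 : ℤ) by simp, coeff_C_mul, coeff_C_mul] at h
  exact mul_left_cancel₀ two_ne_zero h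

/-! ### The action of `U_2` on `λ` -/

/-- The Hecke relation at the prime `2`: the part of `λ` with even exponents is
`-4 λ(q²) - 8 λ(q⁴)`. -/
theorem exists_lam_eq : ∃ u : ℤ⟦X⟧,
    lam = X * expand 2 two_ne_zero u - expand 2 two_ne_zero (4 * lam + 8 * lamSq) := by
  have h5 : (5 : ℕ) ≠ 0 := by decide
  have h10 : (10 : ℕ) ≠ 0 := by decide
  have e10 (x : ℤ⟦X⟧) : expand 10 h10 x = expand 2 two_ne_zero (expand 5 h5 x) :=
    expand_mul 2 two_ne_zero 5 h5 x
  have e10' (x : ℤ⟦X⟧) : expand 10 h10 x = expand 5 h5 (expand 2 two_ne_zero x) :=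
    expand_mul 5 h5 2 two_ne_zero x
  have e4 (x : ℤ⟦X⟧) : expand 4 four_ne_zero x = expand 2 two_ne_zero (expand 2 two_ne_zero x) :=
    expand_mul 2 two_ne_zero 2 two_ne_zero x
  have e52 (x : ℤ⟦X⟧) : expand 5 h5 (expand 2 two_ne_zero x) =
      expand 2 two_ne_zero (expand 5 h5 x) := by rw [← e10, ← e10']
  -- This is the square of `f_one_mul_f_five`, with the cross term rewritten by `psi_sq` at `q` and
  -- `q^5`.
  have key : X ^ 2 * phi ^ 2 * expand 10 h10 psi ^ 2 + expand 5 h5 phi ^ 2 *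
      expand 2 two_ne_zero psi ^ 2 =
      (f 1 * expand 5 h5 (f 1)) ^ 2 + 2 * X * psi ^ 2 * expand 5 h5 psi ^ 2 := by
    have hpsi5 := congrArg (expand 5 h5) psi_sq
    rw [map_pow, map_mul, ← e10'] at hpsi5
    rw [f_one_mul_f_five, hpsi5, psi_sq]
    ring
  have hphi5 := congrArg (expand 5 h5) phiNeg_sq
  have g5 := congrArg (expand 5 h5) phiNeg_mul
  have k1 := congrArg (expand 2 two_ne_zero) psi_mul
  have k5 := congrArg (expand 2 two_ne_zero) (congrArg (expand 5 h5) psi_mul)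
  have hphi := phiNeg_sq
  replace key := congrArg (expand 2 two_ne_zero) key
  simp only [map_pow, map_mul, map_sub, map_add, map_ofNat, expand_X, e10, e4, e52]
    at key hphi hphi5 g5 k1 k5
  -- The witness comes from the two products of like terms in `φ(-q)² φ(-q^5)²`; the mixed products
  -- form the even part of `λ`.
  refine ⟨(phi ^ 2 * expand 5 h5 phi ^ 2 + 16 * X ^ 3 * expand 2 two_ne_zero psi ^ 2 *
    expand 10 h10 psi ^ 2) * (f 1 * expand 5 h5 (f 1)) ^ 2, ?_⟩
  have e1 : X * f 1 ^ 4 * expand 5 h5 (f 1) ^ 4 =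
      X * (f 1 ^ 2) ^ 2 * (expand 5 h5 (f 1) ^ 2) ^ 2 := by ring
  rw [← phiNeg_mul, ← g5, mul_pow, mul_pow, hphi, hphi5] at e1
  rw [lamSq, lam, f_eq_expand h5]
  simp only [map_pow, map_mul, map_add, map_ofNat, expand_X, e10]
  rw [e1]
  -- The multipliers of `k1` and `k5` turn `ψ² ψ(q^5)² f_1² f_5²` into `f_2⁴ f_10⁴` (all at `q²`),
  -- by factoring differences of squares.
  linear_combination
    -4 * X ^ 2 * (expand 2 two_ne_zero (f 1) * expand 2 two_ne_zero (expand 5 h5 (f 1))) ^ 2 * key -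
      8 * X ^ 4 * ((expand 2 two_ne_zero psi * expand 2 two_ne_zero (f 1) +
          expand 2 two_ne_zero (expand 2 two_ne_zero (f 1)) ^ 2) *
        (expand 2 two_ne_zero (expand 5 h5 psi) * expand 2 two_ne_zero (expand 5 h5 (f 1))) ^ 2 *
          k1 + expand 2 two_ne_zero (expand 2 two_ne_zero (f 1)) ^ 4 *
        (expand 2 two_ne_zero (expand 5 h5 psi) * expand 2 two_ne_zero (expand 5 h5 (f 1)) +
          expand 2 two_ne_zero (expand 2 two_ne_zero (expand 5 h5 (f 1))) ^ 2) * k5)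

theorem coeff_two_mul_lam (n : ℕ) :
    coeff (2 * n) lam = -4 * coeff n lam - 8 * coeff n lamSq := by
  obtain ⟨u, hu⟩ := exists_lam_eq
  have hodd : coeff (2 * n) (X * expand 2 two_ne_zero u) = 0 := by
    rcases n with _ | n
    · simp
    · rw [show 2 * (n + 1) = 2 * n + 1 + 1 by ring, coeff_succ_X_mul,
        coeff_expand_of_not_dvd _ _ _ (by omega)]
  rw [hu, map_sub, hodd, coeff_expand_mul, map_add, ← hu,
    show (4 : ℤ⟦X⟧) = C (4 : ℤ) by simp, show (8 : ℤ⟦X⟧) = C (8 : ℤ) by simp, coeff_C_mul,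
    coeff_C_mul]
  ring

theorem coeff_two_mul_lamSq (n : ℕ) : coeff (2 * n) lamSq = coeff n lam :=
  coeff_expand_mul 2 two_ne_zero lam n

theorem P_eq_coeff_lam (n : ℕ) : P n = coeff (n + 1) lam := by
  rw [P, lam, mul_assoc, coeff_succ_X_mul]

/-- `U² λ = 8 λ + 32 V λ`, and one more `U` makes the `λ` terms cancel: `8 · (-4) + 32 = 0`. -/
theorem coeff_eight_mul_lam (n : ℕ) : coeff (8 * n) lam = -64 * coeff n lamSq := by
  have h1 := coeff_two_mul_lam n
  have h2 := coeff_two_mul_lam (2 * n)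
  have h3 := coeff_two_mul_lam (2 * (2 * n))
  simp only [coeff_two_mul_lamSq] at h2 h3
  rw [show 8 * n = 2 * (2 * (2 * n)) by ring]
  linarith

theorem coeff_thirty_two_mul_lam (n : ℕ) :
    coeff (32 * n) lam = 256 * coeff n lam + 512 * coeff n lamSq := by
  have h1 := coeff_two_mul_lam n
  rw [show 32 * n = 8 * (2 * (2 * n)) by ring, coeff_eight_mul_lam, coeff_two_mul_lamSq, h1]
  ring

theorem coeff_sixty_four_mul_lam (n : ℕ) :
    coeff (64 * n) lam = -512 * coeff n lam - 2048 * coeff n lamSq := by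
  have h1 := coeff_two_mul_lam n
  rw [show 64 * n = 32 * (2 * n) by ring, coeff_thirty_two_mul_lam, coeff_two_mul_lamSq, h1]
  ring

/-- `P` is `λ` shifted by one, so the class `k - 1` modulo `k` for `P` is the class 0 for `λ`.
Constant terms agree because that of `λ` is 0. -/
theorem X_mul_mk_P {k : ℕ} (hk : 0 < k) {φ : ℤ⟦X⟧} (h : ∀ n, coeff (k * n) lam = coeff n φ) :
    X * mk (fun n => P (k * n + (k - 1))) = φ := by
  ext n
  rcases n with _ | n
  · rw [← h]
    simp [lam]
  · rw [coeff_succ_X_mul, coeff_mk, P_eq_coeff_lam, ← h, mul_add, mul_one, add_assoc,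
      Nat.sub_add_cancel hk]

end PStar

theorem mainTheorem11 :
    (∀ n : ℕ,
      PStar.P (8 * n + 7) ≡ 0 [ZMOD 64] ∧
      PStar.P (32 * n + 31) ≡ 0 [ZMOD 256] ∧
      PStar.P (64 * n + 63) ≡ 0 [ZMOD 512]) ∧
    PowerSeries.X * PowerSeries.mk (fun n : ℕ => PStar.P (8 * n + 7)) =
      -64 * PStar.lamSq ∧
    PowerSeries.X * PowerSeries.mk (fun n : ℕ => PStar.P (32 * n + 31)) =
      256 * PStar.lam + 512 * PStar.lamSq ∧
    PowerSeries.X * PowerSeries.mk (fun n : ℕ => PStar.P (64 * n + 63)) =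
      -512 * PStar.lam - 2048 * PStar.lamSq := by
  have hC (a : ℤ) (n : ℕ) (x : PowerSeries ℤ) : PowerSeries.coeff n ((a : PowerSeries ℤ) * x) =
      a * PowerSeries.coeff n x := by
    rw [show (a : PowerSeries ℤ) = PowerSeries.C a by simp, PowerSeries.coeff_C_mul]
  refine ⟨fun n => ⟨?_, ?_, ?_⟩, ?_, ?_, ?_⟩
  · rw [PStar.P_eq_coeff_lam, show 8 * n + 7 + 1 = 8 * (n + 1) by ring,
      PStar.coeff_eight_mul_lam]
    exact Int.modEq_zero_iff_dvd.mpr (by omega)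
  · rw [PStar.P_eq_coeff_lam, show 32 * n + 31 + 1 = 32 * (n + 1) by ring,
      PStar.coeff_thirty_two_mul_lam]
    exact Int.modEq_zero_iff_dvd.mpr (by omega)
  · rw [PStar.P_eq_coeff_lam, show 64 * n + 63 + 1 = 64 * (n + 1) by ring,
      PStar.coeff_sixty_four_mul_lam]
    exact Int.modEq_zero_iff_dvd.mpr (by omega)
  · refine PStar.X_mul_mk_P (k := 8) (by norm_num) fun n => ?_
    rw [PStar.coeff_eight_mul_lam]
    exact_mod_cast (hC (-64) n _).symm
  · refine PStar.X_mul_mk_P (k := 32) (by norm_num) fun n => ?_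
    rw [PStar.coeff_thirty_two_mul_lam, map_add]
    exact_mod_cast (congrArg₂ (· + ·) (hC 256 n _) (hC 512 n _)).symm
  · refine PStar.X_mul_mk_P (k := 64) (by norm_num) fun n => ?_
    rw [PStar.coeff_sixty_four_mul_lam, map_sub]
    exact_mod_cast (congrArg₂ (· - ·) (hC (-512) n _) (hC 2048 n _)).symm
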